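/- Let $n\ge 0$ and $[2n]=\{1,\dots,2n\}$. For a set partition $P$ of $[2n]$, let $\min(P)$ and $\max(P)$ be the sets of minimal, respectively maximal, elements of the blocks of $P$. An arc of $P$ is a pair $(i,j)$ with $i<j$ such that $i$ and $j$ lie in the same block of $P$ and no element of that block lies strictly between them. For an integer $k\ge 0$, a $k$-crossing of $P$ is a set of $k$ arcs $(i_1,j_1),\dots,(i_k,j_k)$ of $P$ with $i_1<\cdots<i_k<j_1<\cdots<j_k$, and a $k$-nesting is a set of $k$ arcs with $i_1<\cdots<i_k<j_k<\cdots<j_1$ (so a single arc is both a $1$-crossing and a $1$-nesting, and the empty set is both a $0$-crossing and a $0$-nesting). Let $\mathrm{cr}(P)$ (respectively $\mathrm{ne}(P)$) be the largest $k$ such that $P$ has a $k$-crossing (respectively a $k$-nesting). Call $P$ $k$-noncrossing if it has no $k$-crossing and $k$-nonnesting if it has no $k$-nesting. A (complete) matching on $[2n]$ is a partition of $[2n]$ all of whose blocks have exactly two elements. For $S,T\subseteq[2n]$ let $P_{2n}(S,T)$ be the set of partitions $P$ of $[2n]$ with $\min(P)=S$ and $\max(P)=T$. 1. For all disjoint $S,T\subseteq[2n]$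 with $|S|=|T|=n$, every element of $P_{2n}(S,T)$ is a matching, and $\mathrm{cr}$ and $\mathrm{ne}$ have a symmetric joint distribution over $P_{2n}(S,T)$: for all integers $i,j\ge 0$, the number of $P\in P_{2n}(S,T)$ with $\mathrm{cr}(P)=i$ and $\mathrm{ne}(P)=j$ equals the number of $P\in P_{2n}(S,T)$ with $\mathrm{cr}(P)=j$ and $\mathrm{ne}(P)=i$. 2. Let $f_n(i,j)$ be the number of matchings $M$ on $[2n]$ with $\mathrm{cr}(M)=i$ and $\mathrm{ne}(M)=j$. Then $f_n(i,j)=f_n(j,i)$ for all integers $i,j\ge 0$. 3. For all integers $k,l\ge 0$, the number of matchings on $[2n]$ that are $k$-noncrossing and $l$-nonnesting equals the number of matchings on $[2n]$ that are $l$-noncrossing and $k$-nonnesting. 4. For every integer $k\ge 0$, the number of $k$-noncrossing matchings on $[2n]$ equals the number of $k$-nonnesting matchings on $[2n]$. -/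

import Mathlib

namespace CrossNest

/-- Set partitions of `[N] = {1, …, N}`. -/
abbrev SetPart (N : ℕ) : Type := Finpartition (Finset.Icc 1 N)

variable {N : ℕ}

/-- The arcs of the standard representation of `P`: pairs `(i, j)` with `i < j` such that `i` and
`j` are numerically consecutive elements of a block of `P`. -/
def arcs (P : SetPart N) : Finset (ℕ × ℕ) :=
  (Finset.Icc 1 N ×ˢ Finset.Icc 1 N).filter fun a =>
    a.1 < a.2 ∧ ∃ B ∈ P.parts, a.1 ∈ B ∧ a.2 ∈ B ∧ ∀ c ∈ B, ¬ (a.1 < c ∧ c < a.2)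

/-- `P` has a `k`-crossing: arcs `(i₁, j₁), …, (iₖ, jₖ)` with
`i₁ < ⋯ < iₖ < j₁ < ⋯ < jₖ`. -/
def HasCrossing (P : SetPart N) (k : ℕ) : Prop :=
  ∃ i j : Fin k → ℕ, (∀ r, (i r, j r) ∈ arcs P) ∧
    StrictMono i ∧ StrictMono j ∧ ∀ r s, i r < j s

/-- `P` has a `k`-nesting: arcs `(i₁, j₁), …, (iₖ, jₖ)` with
`i₁ < ⋯ < iₖ < jₖ < ⋯ < j₁`. -/
def HasNesting (P : SetPart N) (k : ℕ) : Prop :=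
  ∃ i j : Fin k → ℕ, (∀ r, (i r, j r) ∈ arcs P) ∧
    StrictMono i ∧ StrictAnti j ∧ ∀ r s, i r < j s

/-- The crossing number: the largest `k` such that `P` has a `k`-crossing. -/
noncomputable def cr (P : SetPart N) : ℕ := sSup {k | HasCrossing P k}

/-- The nesting number: the largest `k` such that `P` has a `k`-nesting. -/
noncomputable def ne (P : SetPart N) : ℕ := sSup {k | HasNesting P k}

/-- `P` is `k`-noncrossing: it has no `k`-crossing. -/
def IsNoncrossing (P : SetPart N) (k : ℕ) : Prop := ¬ HasCrossing P k

/-- `P` is `k`-nonnesting: it has no `k`-nesting. -/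
def IsNonnesting (P : SetPart N) (k : ℕ) : Prop := ¬ HasNesting P k

/-- The set `min(P)` of minimal block elements. -/
def minElts (P : SetPart N) : Finset ℕ :=
  (Finset.Icc 1 N).filter fun x => ∃ B ∈ P.parts, x ∈ B ∧ ∀ y ∈ B, x ≤ y

/-- The set `max(P)` of maximal block elements. -/
def maxElts (P : SetPart N) : Finset ℕ :=
  (Finset.Icc 1 N).filter fun x => ∃ B ∈ P.parts, x ∈ B ∧ ∀ y ∈ B, y ≤ x

/-- The set `P_N(S, T)` of partitions of `[N]` with `min(P) = S` and `max(P) = T`. -/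
def partsWith (N : ℕ) (S T : Finset ℕ) : Set (SetPart N) :=
  {P | minElts P = S ∧ maxElts P = T}

/-- `f_{N,S,T}(i, j)`: the number of `P ∈ P_N(S, T)` with `cr(P) = i` and `ne(P) = j`. -/
noncomputable def fST (N : ℕ) (S T : Finset ℕ) (i j : ℕ) : ℕ :=
  {P : SetPart N | P ∈ partsWith N S T ∧ cr P = i ∧ ne P = j}.ncard

/-- A (complete) matching: every block has exactly two elements. -/
def IsMatching (P : SetPart N) : Prop := ∀ B ∈ P.parts, B.card = 2

/-- `f_n(i, j)`: the number of matchings `M` on `[2n]` with `cr(M) = i` and `ne(M) = j`. -/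
noncomputable def f (n i j : ℕ) : ℕ :=
  {M : SetPart (2 * n) | IsMatching M ∧ cr M = i ∧ ne M = j}.ncard

theorem bounded_of_arcs (P : SetPart N) {k : ℕ} (i j : Fin k → ℕ)
    (h : ∀ r, (i r, j r) ∈ arcs P) (hi : StrictMono i) : k ≤ (arcs P).card := by
  have := Finset.card_le_card_of_injOn (s := (Finset.univ : Finset (Fin k))) (t := arcs P)
    (fun r => (i r, j r)) (fun r _ => h r)
    (fun r _ s _ hrs => hi.injective (Prod.ext_iff.1 hrs).1)
  simpa using this

/-- The supremum defining `cr` is a genuine maximum. -/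
theorem isGreatest_cr (P : SetPart N) : IsGreatest {k | HasCrossing P k} (cr P) := by
  have hb : BddAbove {k | HasCrossing P k} :=
    ⟨(arcs P).card, fun k ⟨i, j, h, hi, _⟩ => bounded_of_arcs P i j h hi⟩
  exact ⟨Nat.sSup_mem ⟨0, Fin.elim0, Fin.elim0, fun r => r.elim0, fun r => r.elim0,
    fun r => r.elim0, fun r => r.elim0⟩ hb, fun k hk => le_csSup hb hk⟩

/-- The supremum defining `ne` is a genuine maximum. -/
theorem isGreatest_ne (P : SetPart N) : IsGreatest {k | HasNesting P k} (ne P) := by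
  have hb : BddAbove {k | HasNesting P k} :=
    ⟨(arcs P).card, fun k ⟨i, j, h, hi, _⟩ => bounded_of_arcs P i j h hi⟩
  exact ⟨Nat.sSup_mem ⟨0, Fin.elim0, Fin.elim0, fun r => r.elim0, fun r => r.elim0,
    fun r => r.elim0, fun r => r.elim0⟩ hb, fun k hk => le_csSup hb hk⟩

end CrossNest

namespace CrossNest

/-! ### Growth diagrams -/

/-! Encode a partition of `[N]` by a 0-1 filling of a staircase: the arc `(i, j)` becomes an entry
in the cell `x = N - j`, `y = i - 1`. Every row and column contains at most one entry. The cells of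
the rectangle with opposite corner `(N - m, m)` correspond to the pairs with `i ≤ m < j`, so a
crossing is a decreasing chain of entries inside one of these rectangles and a nesting is an
increasing chain.

Fomin's growth diagram attaches to each lattice point the RSK shape of the part of the filling to
its lower left. By Schensted's theorem (`lt_growth_zero_iff`, `growth_pos_iff`) its first row is the
length of the longest increasing chain and its number of rows that of the longest decreasing chain.
Hence `cr` and `ne` can be read off the shapes at the outer corners of the staircase.

Now transpose all shapes along the staircase boundary. The local rules are invertible, so the
transposed boundary comes from exactly one filling (`exists_conjFilling`,
`filling_eq_of_growth_eq`). Transposition exchanges rows with columns of shapes, hence crossings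
with nestings. It preserves the sizes of shapes, and differences of sizes along the boundary are the
row and column sums of the filling, so the sets of openers and closers are unchanged. For a matching
these sets partition `[N]`, and the new filling is again that of a matching
(`IsMatching.exists_conj`). All four counts follow from this exchange. -/

/-- Interlacing of shapes: `b` arises from `a` by adding a horizontal strip. -/
def Interlace (a b : ℕ → ℕ) : Prop := ∀ k, a k ≤ b k ∧ b (k + 1) ≤ a k

/-- The forward local rule: the fourth corner of a cell with content `c`. -/
def up (l m n : ℕ → ℕ) (c : ℕ) : ℕ → ℕ
  | 0 => max (m 0) (n 0) + c
  | k + 1 => max (m (k + 1)) (n (k + 1)) + (min (m k) (n k) - l k)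

/-- The backward local rule. -/
def down (m n r : ℕ → ℕ) (k : ℕ) : ℕ :=
  min (m k) (n k) - (r (k + 1) - max (m (k + 1)) (n (k + 1)))

theorem interlace_up_left {l m n : ℕ → ℕ} {c : ℕ} (hm : Interlace l m) (hn : Interlace l n) :
    Interlace m (up l m n c) := by
  intro k
  have h1 := hm k
  have h2 := hn k
  cases k <;> simp only [up] <;> omega

theorem interlace_up_right {l m n : ℕ → ℕ} {c : ℕ} (hm : Interlace l m) (hn : Interlace l n) :
    Interlace n (up l m n c) := by
  intro k
  have h1 := hm k
  have h2 := hn k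
  cases k <;> simp only [up] <;> omega

theorem interlace_down_left {m n r : ℕ → ℕ} (hm : Interlace m r) (hn : Interlace n r) :
    Interlace (down m n r) m := by
  intro k
  have h1 := hm k
  have h2 := hn k
  have h3 := hm (k + 1)
  have h4 := hn (k + 1)
  simp only [down]
  omega

theorem interlace_down_right {m n r : ℕ → ℕ} (hm : Interlace m r) (hn : Interlace n r) :
    Interlace (down m n r) n := by
  intro k
  have h1 := hm k
  have h2 := hn k
  have h3 := hm (k + 1)
  have h4 := hn (k + 1)
  simp only [down]
  omega

/-- Given `m` and `n`, a cell is reversible: `(l, c)` and the fourth shape determine each other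
(this and `down_up`). Interlacing makes every truncated subtraction in `up` and `down` exact, so
both identities are checked row by row. -/
theorem up_down {m n r : ℕ → ℕ} (hm : Interlace m r) (hn : Interlace n r) :
    up (down m n r) m n (r 0 - max (m 0) (n 0)) = r := by
  funext k
  cases k with
  | zero =>
    have h1 := hm 0
    have h2 := hn 0
    simp only [up]
    omega
  | succ k =>
    have h1 := hm k
    have h2 := hn k
    have h3 := hm (k + 1)
    have h4 := hn (k + 1)
    simp only [up, down]
    omega

theorem down_up {l m n : ℕ → ℕ} {c : ℕ} (hm : Interlace l m) (hn : Interlace l n) :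
    down m n (up l m n c) = l := by
  funext k
  have h1 := hm k
  have h2 := hn k
  simp only [up, down]
  omega

/-- The growth diagram of a filling `X` of the quadrant: the shape at each lattice point. -/
def growth (X : ℕ → ℕ → ℕ) : ℕ → ℕ → ℕ → ℕ
  | 0, _ => 0
  | _ + 1, 0 => 0
  | x + 1, y + 1 => up (growth X x y) (growth X (x + 1) y) (growth X x (y + 1)) (X x y)

@[simp] theorem growth_zero_left (X : ℕ → ℕ → ℕ) (y : ℕ) : growth X 0 y = 0 := by
  simp [growth]

@[simp] theorem growth_zero_right (X : ℕ → ℕ → ℕ) (x : ℕ) : growth X x 0 = 0 := by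
  cases x <;> simp [growth]

theorem growth_succ (X : ℕ → ℕ → ℕ) (x y : ℕ) : growth X (x + 1) (y + 1) =
    up (growth X x y) (growth X (x + 1) y) (growth X x (y + 1)) (X x y) := by
  rw [growth]

theorem up_comm (l m n : ℕ → ℕ) (c : ℕ) : up l m n c = up l n m c := by
  funext k
  cases k <;> simp only [up, max_comm, min_comm]

theorem growth_swap (X : ℕ → ℕ → ℕ) (x y : ℕ) :
    growth (Function.swap X) x y = growth X y x := by
  induction x generalizing y with
  | zero => simp
  | succ x ihx =>
    induction y with
    | zero => simp
    | succ y ihy =>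
      rw [growth_succ, growth_succ, ihx, ihy, ihx, up_comm]

theorem growth_interlace (X : ℕ → ℕ → ℕ) (x y : ℕ) :
    Interlace (growth X x y) (growth X (x + 1) y) ∧
      Interlace (growth X x y) (growth X x (y + 1)) := by
  have h0 : Interlace (0 : ℕ → ℕ) 0 := fun k => by simp
  have key : ∀ x y, (Interlace (growth X x y) (growth X (x + 1) y)) ∧
      Interlace (growth X x y) (growth X x (y + 1)) := by
    intro x
    induction x with
    | zero =>
      intro y
      refine ⟨?_, by simpa using h0⟩
      induction y with
      | zero => simpa using h0
      | succ y ih =>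
        rw [growth_succ]
        exact interlace_up_right ih (by simpa using h0)
    | succ x ihx =>
      intro y
      induction y with
      | zero =>
        refine ⟨by simpa using h0, ?_⟩
        rw [growth_succ]
        exact interlace_up_left (ihx 0).1 (ihx 0).2
      | succ y ihy =>
        have h1 : Interlace (growth X (x + 1) (y + 1)) (growth X (x + 1 + 1) (y + 1)) := by
          rw [growth_succ X (x + 1) y]
          exact interlace_up_right ihy.1 ihy.2
        refine ⟨h1, ?_⟩
        rw [growth_succ X x (y + 1)]
        exact interlace_up_left (ihx (y + 1)).1 (ihx (y + 1)).2
  exact key x y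

theorem growth_mono (X : ℕ → ℕ → ℕ) {x x' y y' : ℕ} (hx : x ≤ x') (hy : y ≤ y') (k : ℕ) :
    growth X x y k ≤ growth X x' y' k :=
  (monotone_nat_of_le_succ (f := fun x => growth X x y k)
    (fun x => ((growth_interlace X x y).1 k).1) hx).trans
  (monotone_nat_of_le_succ (f := fun y => growth X x' y k)
    (fun y => ((growth_interlace X x' y).2 k).1) hy)

theorem growth_antitone (X : ℕ → ℕ → ℕ) (x y : ℕ) : Antitone (growth X x y) := by
  refine antitone_nat_of_succ_le fun k => ?_
  cases x with
  | zero => simp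
  | succ x =>
    have h := (growth_interlace X x y).1 k
    omega

/-- Each vertical step adds a horizontal strip, so it creates at most one new row. -/
theorem growth_eq_zero (X : ℕ → ℕ → ℕ) (x y k : ℕ) (h : y ≤ k) : growth X x y k = 0 := by
  induction y generalizing k with
  | zero => simp
  | succ y ih =>
    obtain ⟨k, rfl⟩ : ∃ j, k = j + 1 := ⟨k - 1, by omega⟩
    have h1 := ((growth_interlace X x y).2 k).2
    have h2 := ih k (by omega)
    omega

/-! ### Removing the first row: Viennot's shadow construction -/

/-- The filling left after the first row of every shape in the growth diagram is removed. -/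
def shadow (X : ℕ → ℕ → ℕ) (x y : ℕ) : ℕ :=
  min (growth X (x + 1) y 0) (growth X x (y + 1) 0) - growth X x y 0

/-- In `up`, row `k + 1` sees row `k` only through the overlap `min (m k) (n k) - l k`. Reading the
overlap of the first row as the content of the cell, the remaining rows obey the same recursion.
This allows induction on the row index with `X` replaced by its shadow. -/
theorem growth_apply_succ (X : ℕ → ℕ → ℕ) (x y k : ℕ) :
    growth X x y (k + 1) = growth (shadow X) x y k := by
  induction x generalizing y k with
  | zero => simp
  | succ x ihx =>
    induction y generalizing k with
    | zero => simp
    | succ y ihy =>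
      rw [growth_succ, growth_succ]
      cases k with
      | zero => simp only [up, ihx, ihy]; rfl
      | succ k => simp only [up, ihx, ihy]

theorem shadow_swap (X : ℕ → ℕ → ℕ) : shadow (Function.swap X) = Function.swap (shadow X) := by
  funext x y
  simp only [shadow, Function.swap, growth_swap, min_comm]

/-- `∑_{b < y} X x b` splits into the contribution of the shadow and that of the first row. -/
theorem sum_col (X : ℕ → ℕ → ℕ) (x y : ℕ) :
    ∑ b ∈ Finset.range y, X x b + growth X x y 0 =
      ∑ b ∈ Finset.range y, shadow X x b + growth X (x + 1) y 0 := by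
  induction y with
  | zero => simp
  | succ y ih =>
    rw [Finset.sum_range_succ, Finset.sum_range_succ, growth_succ]
    have h1 := (growth_interlace X x y).1 0
    have h2 := (growth_interlace X x y).2 0
    simp only [up, shadow] at *
    omega

theorem sum_row (X : ℕ → ℕ → ℕ) (x y : ℕ) :
    ∑ a ∈ Finset.range x, X a y + growth X x y 0 =
      ∑ a ∈ Finset.range x, shadow X a y + growth X x (y + 1) 0 := by
  have := sum_col (Function.swap X) y x
  rw [growth_swap X y x, growth_swap X (y + 1) x, shadow_swap] at this
  exact this

/-- The size of the growth along a horizontal edge is the sum of the entries below it. -/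
theorem sum_growth_col (X : ℕ → ℕ → ℕ) (x y K : ℕ) (hK : y ≤ K) :
    ∑ b ∈ Finset.range y, X x b + ∑ k ∈ Finset.range K, growth X x y k =
      ∑ k ∈ Finset.range K, growth X (x + 1) y k := by
  have key : ∀ K, ∀ X : ℕ → ℕ → ℕ,
      ∑ b ∈ Finset.range y, X x b + ∑ k ∈ Finset.range K, growth X x y k =
      ∑ b ∈ Finset.range y, (shadow^[K] X) x b + ∑ k ∈ Finset.range K, growth X (x + 1) y k := by
    intro K
    induction K with
    | zero => intro X; simp
    | succ K ih =>
      intro X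
      have h1 := ih (shadow X)
      have h2 := sum_col X x y
      rw [Finset.sum_range_succ', Finset.sum_range_succ' _ K]
      simp only [growth_apply_succ, Function.iterate_succ, Function.comp_apply]
      omega
  have hG : ∀ K, ∀ X : ℕ → ℕ → ℕ, ∀ x y, growth (shadow^[K] X) x y 0 = growth X x y K := by
    intro K
    induction K with
    | zero => intros; rfl
    | succ K ih => intro X x y; rw [growth_apply_succ, ← ih]; rfl
  -- The `K`-fold shadow vanishes in this range: the first row of its growth is row `K` of the
  -- original one, which is empty at heights at most `y ≤ K`, and an entry would make it nonempty.
  rw [key K X, Finset.sum_eq_zero, zero_add]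
  intro b hb
  rw [Finset.mem_range] at hb
  have h := hG K X (x + 1) (b + 1)
  rw [growth_succ, growth_eq_zero X _ _ K (by omega)] at h
  simp only [up] at h
  omega

theorem sum_growth_row (X : ℕ → ℕ → ℕ) (x y K : ℕ) (hK : x ≤ K) :
    ∑ a ∈ Finset.range x, X a y + ∑ k ∈ Finset.range K, growth X x y k =
      ∑ k ∈ Finset.range K, growth X x (y + 1) k := by
  have := sum_growth_col (Function.swap X) y x K hK
  rw [growth_swap X y x, growth_swap X (y + 1) x] at this
  exact this

/-! ### Schensted's theorem -/

/-- Every row and every column has sum at most one. -/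
structure IsPartialPerm (X : ℕ → ℕ → ℕ) : Prop where
  col : ∀ x y, ∑ b ∈ Finset.range y, X x b ≤ 1
  row : ∀ x y, ∑ a ∈ Finset.range x, X a y ≤ 1


theorem IsPartialPerm.swap {X : ℕ → ℕ → ℕ} (hX : IsPartialPerm X) :
    IsPartialPerm (Function.swap X) :=
  ⟨fun x y => hX.row y x, fun x y => hX.col y x⟩

/-- By `sum_col` and `sum_row`, a partial row or column sum of the shadow is that of `X` minus the
increase of the first row of the growth, which is nonnegative. -/
theorem IsPartialPerm.shadow {X : ℕ → ℕ → ℕ} (hX : IsPartialPerm X) :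
    IsPartialPerm (shadow X) := by
  constructor
  · intro x y
    have h1 := sum_col X x y
    have h2 := hX.col x y
    have h3 := ((growth_interlace X x y).1 0).1
    omega
  · intro x y
    have h1 := sum_row X x y
    have h2 := hX.row x y
    have h3 := ((growth_interlace X x y).2 0).1
    omega

theorem IsPartialPerm.le_one {X : ℕ → ℕ → ℕ} (hX : IsPartialPerm X) (x y : ℕ) : X x y ≤ 1 := by
  have h := hX.col x (y + 1)
  rw [Finset.sum_range_succ] at h
  omega

/-- An entry of a column fills up every sum over a range containing it. -/
theorem IsPartialPerm.col_eq_one {X : ℕ → ℕ → ℕ} (hX : IsPartialPerm X) {x b y : ℕ}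
    (h : X x b ≠ 0) (hb : b < y) : ∑ b ∈ Finset.range y, X x b = 1 := by
  have h1 := hX.col x y
  have h2 := Finset.single_le_sum (f := X x) (fun _ _ => Nat.zero_le _) (Finset.mem_range.2 hb)
  omega

theorem IsPartialPerm.row_eq_one {X : ℕ → ℕ → ℕ} (hX : IsPartialPerm X) {x a y : ℕ}
    (h : X a y ≠ 0) (ha : a < x) : ∑ a ∈ Finset.range x, X a y = 1 :=
  hX.swap.col_eq_one h ha

theorem IsPartialPerm.col_eq_zero {X : ℕ → ℕ → ℕ} (hX : IsPartialPerm X) {x b y : ℕ}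
    (h : X x b ≠ 0) (hb : y ≤ b) : ∑ b ∈ Finset.range y, X x b = 0 := by
  have h1 := hX.col_eq_one h (Nat.lt_succ_self b)
  rw [Finset.sum_range_succ] at h1
  have h2 := Finset.sum_le_sum_of_subset (f := X x) (Finset.range_mono hb)
  omega

theorem IsPartialPerm.row_eq_zero {X : ℕ → ℕ → ℕ} (hX : IsPartialPerm X) {x a y : ℕ}
    (h : X a y ≠ 0) (ha : x ≤ a) : ∑ a ∈ Finset.range x, X a y = 0 :=
  hX.swap.col_eq_zero h ha

theorem IsPartialPerm.col_unique {X : ℕ → ℕ → ℕ} (hX : IsPartialPerm X) {x b b' : ℕ}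
    (h : X x b ≠ 0) (h' : X x b' ≠ 0) : b = b' := by
  by_contra hne
  wlog hlt : b < b' generalizing b b'
  · exact this h' h (Ne.symm hne) (by omega)
  have h1 := hX.col_eq_zero h' le_rfl
  have h2 := hX.col_eq_one h hlt
  omega

theorem IsPartialPerm.row_unique {X : ℕ → ℕ → ℕ} (hX : IsPartialPerm X) {a a' y : ℕ}
    (h : X a y ≠ 0) (h' : X a' y ≠ 0) : a = a' :=
  hX.swap.col_unique h h'

theorem growth_le {X : ℕ → ℕ → ℕ} (hX : IsPartialPerm X) (x y k : ℕ) :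
    growth X x y k ≤ x := by
  refine (growth_antitone X x y (Nat.zero_le k)).trans ?_
  induction x with
  | zero => simp
  | succ x ih =>
    have h1 := sum_col X x y
    have h2 := hX.col x y
    omega

/-! ### Increasing chains and the first row -/

/-- `X` has an increasing chain of `k + 1` entries ending at `(a, b)`. -/
def IncEnd (X : ℕ → ℕ → ℕ) : ℕ → ℕ → ℕ → Prop
  | 0, a, b => X a b ≠ 0
  | k + 1, a, b => X a b ≠ 0 ∧ ∃ a' < a, ∃ b' < b, IncEnd X k a' b'

/-- `X` has a decreasing chain of `k + 1` entries below height `y` ending at `(a, b)`. -/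
def DecEnd (X : ℕ → ℕ → ℕ) (y : ℕ) : ℕ → ℕ → ℕ → Prop
  | 0, a, b => X a b ≠ 0 ∧ b < y
  | k + 1, a, b => X a b ≠ 0 ∧ ∃ a' < a, ∃ b' > b, DecEnd X y k a' b'

theorem IncEnd.ne_zero {X : ℕ → ℕ → ℕ} {k a b : ℕ} (h : IncEnd X k a b) : X a b ≠ 0 := by
  cases k with
  | zero => exact h
  | succ k => exact h.1

theorem DecEnd.ne_zero {X : ℕ → ℕ → ℕ} {y k a b : ℕ} (h : DecEnd X y k a b) : X a b ≠ 0 := by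
  cases k with
  | zero => exact h.1
  | succ k => exact h.1

theorem growth_corner (X : ℕ → ℕ → ℕ) (x y : ℕ) :
    growth X x y 0 + X x y ≤ growth X (x + 1) (y + 1) 0 := by
  rw [growth_succ]
  have h1 := ((growth_interlace X x y).1 0).1
  simp only [up]
  omega

theorem IncEnd.lt_growth {X : ℕ → ℕ → ℕ} {k a b : ℕ} (h : IncEnd X k a b) :
    k < growth X (a + 1) (b + 1) 0 := by
  induction k generalizing a b with
  | zero =>
    have h1 := growth_corner X a b
    have h2 := h.ne_zero
    omega
  | succ k ih =>
    obtain ⟨h2, a', ha, b', hb, h'⟩ := h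
    have h1 := growth_corner X a b
    have h3 := ih h'
    have h4 := growth_mono X (show a' + 1 ≤ a from ha) (show b' + 1 ≤ b from hb) 0
    omega

theorem exists_incEnd {X : ℕ → ℕ → ℕ} (hX : IsPartialPerm X) {x y k : ℕ}
    (h : k < growth X x y 0) : ∃ a < x, ∃ b < y, IncEnd X k a b := by
  induction x generalizing y k with
  | zero => simp at h
  | succ x ihx =>
    induction y with
    | zero => simp at h
    | succ y ihy =>
      by_cases h1 : k < growth X (x + 1) y 0
      · obtain ⟨a, ha, b, hb, hab⟩ := ihy h1
        exact ⟨a, ha, b, by omega, hab⟩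
      by_cases h2 : k < growth X x (y + 1) 0
      · obtain ⟨a, ha, b, hb, hab⟩ := ihx h2
        exact ⟨a, by omega, b, hb, hab⟩
      rw [growth_succ] at h
      simp only [up] at h
      -- The first row exceeds both neighbouring ones only through an entry in this cell. The rest
      -- of the column below it and of the row to its left is then empty, so the other three corners
      -- share the same first row, of length exactly `k`, and the chain is extended from the corner
      -- `(x, y)`.
      have h3 : X x y ≠ 0 := by omega
      have h4 := hX.le_one x y
      have h5 := sum_col X x y
      rw [hX.col_eq_zero h3 le_rfl] at h5
      have h6 := sum_row X x y
      rw [hX.row_eq_zero h3 le_rfl] at h6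
      have h7 := ((growth_interlace X x y).1 0).1
      have h8 := ((growth_interlace X x y).2 0).1
      refine ⟨x, by omega, y, by omega, ?_⟩
      cases k with
      | zero => exact h3
      | succ k =>
        obtain ⟨a, ha, b, hb, hab⟩ := ihx (y := y) (k := k) (by omega)
        exact ⟨h3, a, ha, b, hb, hab⟩

/-- The first row of the growth shape is the length of the longest increasing chain. -/
theorem lt_growth_zero_iff {X : ℕ → ℕ → ℕ} (hX : IsPartialPerm X) (x y k : ℕ) :
    k < growth X x y 0 ↔ ∃ a < x, ∃ b < y, IncEnd X k a b := by
  refine ⟨exists_incEnd hX, ?_⟩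
  rintro ⟨a, ha, b, hb, h⟩
  exact h.lt_growth.trans_le (growth_mono X ha hb 0)

/-! ### Decreasing chains and the number of rows -/

/-- Between two entries forming a decreasing pair there is an entry of the shadow. -/
theorem exists_shadow_between {X : ℕ → ℕ → ℕ} (hX : IsPartialPerm X) {a b a' b' : ℕ}
    (h : X a b ≠ 0) (h' : X a' b' ≠ 0) (ha : a < a') (hb : b' < b) :
    ∃ u v, shadow X u v ≠ 0 ∧ a < u ∧ u ≤ a' ∧ b' < v ∧ v ≤ b := by
  by_contra! hcon
  -- If row `b` has no shadow entry left of `a'` and column `a'` none below `b`, the first row grows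
  -- along both edges leaving `(a', b)`, which forces a shadow entry in that very cell.
  have h1 := sum_row X a' b
  rw [hX.row_eq_one h ha, Finset.sum_eq_zero] at h1
  · have h2 := sum_col X a' b
    rw [hX.col_eq_one h' hb, Finset.sum_eq_zero] at h2
    · have h3 : shadow X a' b ≠ 0 := by
        simp only [shadow]
        omega
      have := hcon a' b h3 ha le_rfl hb
      omega
    · intro v hv
      rw [Finset.mem_range] at hv
      by_contra h3
      have h4 : ¬ b' < v := fun h5 => by
        have := hcon a' v h3 ha le_rfl h5
        omega
      -- A shadow entry in column `a'` at height at most `b'` is impossible: it would cancel the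
      -- increase of the first row that the entry of `X` at `(a', b')` produces.
      have h6 := sum_col X a' (b' + 1)
      rw [hX.col_eq_one h' (Nat.lt_succ_self b'), hX.shadow.col_eq_one h3 (by omega)] at h6
      have h7 := growth_corner X a' b'
      have h8 := sum_col X a' b'
      rw [hX.col_eq_zero h' le_rfl] at h8
      have h9 := sum_row X a' b'
      rw [hX.row_eq_zero h' le_rfl] at h9
      have h10 := ((growth_interlace X a' b').2 0).1
      omega
  · intro u hu
    rw [Finset.mem_range] at hu
    by_contra h3
    have h4 : ¬ a < u := fun h5 => by
      have := hcon u b h3 h5 hu.le hb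
      omega
    have h6 := sum_row X (a + 1) b
    rw [hX.row_eq_one h (Nat.lt_succ_self a), hX.shadow.row_eq_one h3 (by omega)] at h6
    have h7 := growth_corner X a b
    have h8 := sum_col X a b
    rw [hX.col_eq_zero h le_rfl] at h8
    have h10 := ((growth_interlace X a b).1 0).1
    have h9 := sum_row X a b
    rw [hX.row_eq_zero h le_rfl] at h9
    omega

/-- An entry of the shadow has an entry of `X` below it. -/
theorem exists_below_shadow {X : ℕ → ℕ → ℕ} {a b : ℕ} (h : shadow X a b ≠ 0) :
    ∃ v < b, X a v ≠ 0 := by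
  by_contra! hcon
  have h1 := sum_col X a b
  rw [Finset.sum_eq_zero fun v hv => hcon v (Finset.mem_range.1 hv)] at h1
  simp only [shadow] at h
  omega

/-- An entry of the shadow has an entry of `X` to its left. -/
theorem exists_left_shadow {X : ℕ → ℕ → ℕ} {a b : ℕ} (h : shadow X a b ≠ 0) :
    ∃ u < a, X u b ≠ 0 :=
  exists_below_shadow (X := Function.swap X) (by rw [shadow_swap]; exact h)

/-- Between two shadow entries forming a decreasing pair there is an entry of `X`. -/
theorem exists_between_shadow {X : ℕ → ℕ → ℕ} (hX : IsPartialPerm X) {a b a' b' : ℕ}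
    (h : shadow X a b ≠ 0) (h' : shadow X a' b' ≠ 0) (ha : a < a') (hb : b' < b) :
    ∃ u v, X u v ≠ 0 ∧ a ≤ u ∧ u < a' ∧ b' ≤ v ∧ v < b := by
  obtain ⟨v, hv, hav⟩ := exists_below_shadow h
  by_cases hv' : b' ≤ v
  · exact ⟨a, v, hav, le_rfl, ha, hv', hv⟩
  obtain ⟨u, hu, hub⟩ := exists_left_shadow h'
  by_cases hu' : a ≤ u
  · exact ⟨u, b', hub, hu', hu, le_rfl, hb⟩
  -- With both entries of `X` outside the window, the first row grows along both edges leaving `(a,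
  -- b')`. This yields a second shadow entry in column `a`.
  exfalso
  have h1 := sum_col X a b'
  rw [hX.col_eq_one hav (by omega), hX.shadow.col_eq_zero h hb.le] at h1
  have h2 := sum_row X a b'
  rw [hX.row_eq_one hub (by omega), hX.shadow.row_eq_zero h' ha.le] at h2
  have h3 : shadow X a b' ≠ 0 := by
    simp only [shadow]
    omega
  have := hX.shadow.col_unique h h3
  omega

/-- Start from the entry of `X` to the left of the first shadow entry, which has the same height and
so respects the bound `y`; then pick an entry of `X` between each two consecutive shadow entries.
The resulting chain stops strictly left of `a` and no lower than `b`, leaving room for the entry of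
`X` below the last shadow entry: this is the extra element gained in `growth_pos_iff`. -/
theorem DecEnd.lift_shadow {X : ℕ → ℕ → ℕ} (hX : IsPartialPerm X) {y k a b : ℕ}
    (h : DecEnd (shadow X) y k a b) : ∃ u < a, ∃ v ≥ b, DecEnd X y k u v := by
  induction k generalizing a b with
  | zero =>
    obtain ⟨u, hu, hub⟩ := exists_left_shadow h.1
    exact ⟨u, hu, b, le_rfl, hub, h.2⟩
  | succ k ih =>
    obtain ⟨h0, a', ha, b', hb, h'⟩ := h
    obtain ⟨u, hu, v, hv, huv⟩ := ih h'
    obtain ⟨s, t, hst, h1, h2, h3, h4⟩ := exists_between_shadow hX h'.ne_zero h0 ha hb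
    exact ⟨s, h2, t, h3, hst, u, by omega, v, by omega, huv⟩

/-- Each two consecutive entries of the chain have a shadow entry between them, and these again form
a decreasing chain, shorter by one. -/
theorem DecEnd.exists_shadow {X : ℕ → ℕ → ℕ} (hX : IsPartialPerm X) {y k a b : ℕ}
    (h : DecEnd X y (k + 1) a b) : ∃ u ≤ a, ∃ v > b, DecEnd (shadow X) y k u v := by
  induction k generalizing a b with
  | zero =>
    obtain ⟨h0, a', ha, b', hb, h1, h2⟩ := h
    obtain ⟨u, v, huv, h3, h4, h5, h6⟩ := exists_shadow_between hX h1 h0 ha hb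
    exact ⟨u, h4, v, h5, huv, by omega⟩
  | succ k ih =>
    obtain ⟨h0, a', ha, b', hb, h'⟩ := h
    obtain ⟨u, hu, v, hv, huv⟩ := ih h'
    obtain ⟨s, t, hst, h3, h4, h5, h6⟩ := exists_shadow_between hX h'.ne_zero h0 ha hb
    exact ⟨s, h4, t, h5, hst, u, by omega, v, by omega, huv⟩

/-- The number of rows of the growth shape is the length of the longest decreasing chain. -/
theorem growth_pos_iff {X : ℕ → ℕ → ℕ} (hX : IsPartialPerm X) (x y k : ℕ) :
    0 < growth X x y k ↔ ∃ a < x, ∃ b, DecEnd X y k a b := by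
  induction k generalizing X with
  | zero =>
    rw [lt_growth_zero_iff hX]
    simp only [IncEnd, DecEnd]
    tauto
  | succ k ih =>
    rw [growth_apply_succ, ih hX.shadow]
    constructor
    · rintro ⟨a, ha, b, h⟩
      obtain ⟨v, hv, hav⟩ := exists_below_shadow h.ne_zero
      obtain ⟨u, hu, w, hw, huw⟩ := h.lift_shadow hX
      exact ⟨a, ha, v, hav, u, hu, w, by omega, huw⟩
    · rintro ⟨a, ha, b, h⟩
      obtain ⟨u, hu, v, -, huv⟩ := h.exists_shadow hX
      exact ⟨u, by omega, v, huv⟩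

/-! ### Conjugate shapes -/

/-- The shapes `f` and `g` are transposes of each other. -/
def Conj (f g : ℕ → ℕ) : Prop := ∀ i j, j < f i ↔ i < g j

theorem Conj.symm {f g : ℕ → ℕ} (h : Conj f g) : Conj g f := fun i j => (h j i).symm

theorem Conj.eq {f f' g : ℕ → ℕ} (h : Conj f g) (h' : Conj f' g) : f = f' := by
  funext i
  exact eq_of_forall_lt_iff fun j => (h i j).trans (h' i j).symm

theorem exists_conj {f : ℕ → ℕ} (hf : Antitone f) {K : ℕ} (hK : f K = 0) : ∃ g, Conj f g := by
  have hex : ∀ j, ∃ i, f i ≤ j := fun j => ⟨K, by omega⟩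
  refine ⟨fun j => Nat.find (hex j), fun i j => ?_⟩
  rw [Nat.lt_find_iff]
  constructor
  · intro h m hm
    have := hf hm
    omega
  · intro h
    have := h i le_rfl
    omega

/-- Both sums count the boxes of the shape inside a `K × K` square, by rows and by columns. -/
theorem Conj.sum_eq {f g : ℕ → ℕ} (h : Conj f g) {K : ℕ} (h0 : ∀ k, K ≤ k → f k = 0)
    (hK : ∀ k, f k ≤ K) : ∑ k ∈ Finset.range K, f k = ∑ k ∈ Finset.range K, g k := by
  have key : ∀ m ≤ K, m = ∑ j ∈ Finset.range K, if j < m then 1 else 0 := by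
    intro m hm
    rw [← Finset.card_filter, show (Finset.range K).filter (· < m) = Finset.range m by
      ext j; simp; omega, Finset.card_range]
  have hg : ∀ k, g k ≤ K := by
    intro k
    by_contra hk
    have := (h K k).2 (by omega)
    rw [h0 K le_rfl] at this
    omega
  rw [Finset.sum_congr rfl fun k _ => key (f k) (hK k),
    Finset.sum_congr rfl fun k _ => key (g k) (hg k), Finset.sum_comm]
  simp only [h _ _]

/-- The hypotheses say that `f'` arises from `f` by a vertical strip, and transposition turns
vertical strips into horizontal ones. -/
theorem Conj.interlace {f f' g g' : ℕ → ℕ} (h : Conj f g) (h' : Conj f' g')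
    (hle : ∀ k, f k ≤ f' k) (hle' : ∀ k, f' k ≤ f k + 1) : Interlace g g' := by
  intro j
  constructor
  · by_contra! hlt
    have h1 := (h _ _).2 hlt
    have h2 := (h' (g' j) j).1 (h1.trans_le (hle _))
    omega
  · by_contra! hlt
    have h1 := (h' _ _).2 hlt
    have h2 := (not_congr (h (g j) j)).2 (lt_irrefl _)
    have h3 := hle' (g j)
    omega

/-- For a partial permutation every edge of the diagram adds at most one box to each row; the bound
for the first row passes to the others through the shadow. This makes the transposed shapes
interlace. -/
theorem growth_succ_le_col {X : ℕ → ℕ → ℕ} (hX : IsPartialPerm X) (x y k : ℕ) :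
    growth X (x + 1) y k ≤ growth X x y k + 1 := by
  induction k generalizing X with
  | zero =>
    have h1 := sum_col X x y
    have h2 := hX.col x y
    omega
  | succ k ih =>
    rw [growth_apply_succ, growth_apply_succ]
    exact ih hX.shadow

theorem growth_succ_le_row {X : ℕ → ℕ → ℕ} (hX : IsPartialPerm X) (x y k : ℕ) :
    growth X x (y + 1) k ≤ growth X x y k + 1 := by
  have := growth_succ_le_col hX.swap y x k
  rwa [growth_swap X (y + 1) x, growth_swap X y x] at this

/-! ### Reconstruction of a filling of the staircase from the shapes on its boundary -/

/-- The shapes obtained by the backward rules from the shapes `l` at the outer corners and `m` at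
the inner corners of a staircase; the first argument is the distance from the boundary. -/
def retro (l m : ℕ → ℕ → ℕ) : ℕ → ℕ → ℕ → ℕ
  | 0, y => l y
  | 1, y => m y
  | t + 2, y => down (retro l m (t + 1) y) (retro l m (t + 1) (y + 1)) (retro l m t (y + 1))

theorem retro_interlace {l m : ℕ → ℕ → ℕ} (h1 : ∀ y, Interlace (m y) (l y))
    (h2 : ∀ y, Interlace (m y) (l (y + 1))) (t y : ℕ) :
    Interlace (retro l m (t + 1) y) (retro l m t y) ∧
      Interlace (retro l m (t + 1) y) (retro l m t (y + 1)) := by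
  induction t generalizing y with
  | zero => exact ⟨h1 y, h2 y⟩
  | succ t ih =>
    rw [retro]
    exact ⟨interlace_down_left (ih y).2 (ih (y + 1)).1,
      interlace_down_right (ih y).2 (ih (y + 1)).1⟩

/-- The filling of the staircase of size `N` given by the backward rules. -/
def retroFilling (N : ℕ) (l m : ℕ → ℕ → ℕ) (x y : ℕ) : ℕ :=
  if x + y + 2 ≤ N then
    retro l m (N - x - y - 2) (y + 1) 0 - max (retro l m (N - x - y - 1) y 0)
      (retro l m (N - x - y - 1) (y + 1) 0)
  else 0

/-- `retro l m t y` stands at the lattice point `(N - t - y, y)`. The backward shapes decrease away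
from the boundary, so the empty shapes at the two ends force empty shapes along both axes. From
there `up_down` identifies them with the forward growth, cell by cell. -/
theorem growth_retroFilling {N : ℕ} {l m : ℕ → ℕ → ℕ} (h1 : ∀ y, Interlace (m y) (l y))
    (h2 : ∀ y, Interlace (m y) (l (y + 1))) (h0 : l 0 = 0) (hN : l N = 0) (x y : ℕ)
    (hxy : x + y ≤ N) : growth (retroFilling N l m) x y = retro l m (N - x - y) y := by
  have hr := retro_interlace h1 h2
  induction x generalizing y with
  | zero =>
    have key : ∀ t y k, retro l m t y k ≤ l (y + t) k := by
      intro t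
      induction t with
      | zero => intro y k; exact le_rfl
      | succ t ih =>
        intro y k
        have h3 := ((hr t y).2 k).1
        have h4 := ih (y + 1) k
        rw [show y + 1 + t = y + (t + 1) by omega] at h4
        omega
    funext k
    have h3 := key (N - 0 - y) y k
    rw [show y + (N - 0 - y) = N by omega, hN] at h3
    simp only [Pi.zero_apply, growth_zero_left] at *
    omega
  | succ x ihx =>
    induction y with
    | zero =>
      have key : ∀ t k, retro l m t 0 k ≤ l 0 k := by
        intro t
        induction t with
        | zero => intro k; exact le_rfl
        | succ t ih =>
          intro k
          have h3 := ((hr t 0).1 k).1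
          have h4 := ih k
          omega
      funext k
      have h3 := key (N - (x + 1) - 0) k
      rw [h0] at h3
      simp only [Pi.zero_apply, growth_zero_right] at *
      omega
    | succ y ihy =>
      obtain ⟨t, ht⟩ : ∃ t, N = x + y + 2 + t := ⟨N - (x + y + 2), by omega⟩
      rw [growth_succ, ihx y (by omega), ihx (y + 1) (by omega), ihy (by omega), retroFilling,
        if_pos (by omega), show N - x - y - 2 = t by omega, show N - x - y - 1 = t + 1 by omega,
        show N - x - y = t + 2 by omega, show N - x - (y + 1) = t + 1 by omega,
        show N - (x + 1) - y = t + 1 by omega, show N - (x + 1) - (y + 1) = t by omega, retro]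
      exact up_down (hr t y).2 (hr t (y + 1)).1

/-- A filling of the staircase is determined by the shapes on the boundary. -/
theorem filling_eq_of_growth_eq {N : ℕ} {X X' : ℕ → ℕ → ℕ}
    (hX : ∀ x y, X x y ≠ 0 → x + y + 2 ≤ N) (hX' : ∀ x y, X' x y ≠ 0 → x + y + 2 ≤ N)
    (h1 : ∀ y, growth X (N - y) y = growth X' (N - y) y)
    (h2 : ∀ y, growth X (N - 1 - y) y = growth X' (N - 1 - y) y) : X = X' := by
  -- Two adjacent antidiagonals determine the next one by the backward rule, so the induction
  -- carries a pair of them, at distances `t` and `t + 1` from the boundary.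
  have key : ∀ t, ∀ x y, (x + y + t = N → growth X x y = growth X' x y) ∧
      (x + y + (t + 1) = N → growth X x y = growth X' x y) := by
    intro t
    induction t with
    | zero =>
      intro x y
      refine ⟨fun h => ?_, fun h => ?_⟩
      · rw [show x = N - y by omega]; exact h1 y
      · rw [show x = N - 1 - y by omega]; exact h2 y
    | succ t ih =>
      intro x y
      refine ⟨(ih x y).2, fun h => ?_⟩
      have e : ∀ Z : ℕ → ℕ → ℕ, growth Z x y =
          down (growth Z (x + 1) y) (growth Z x (y + 1)) (growth Z (x + 1) (y + 1)) := by
        intro Z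
        rw [growth_succ, down_up (growth_interlace Z x y).1 (growth_interlace Z x y).2]
      rw [e X, e X', (ih (x + 1) y).2 (by omega), (ih x (y + 1)).2 (by omega),
        (ih (x + 1) (y + 1)).1 (by omega)]
  funext x y
  by_cases hxy : x + y + 2 ≤ N
  · have e1 := (key (N - (x + y + 2)) (x + 1) (y + 1)).1 (by omega)
    have e2 := (key (N - (x + y + 2)) (x + 1) y).2 (by omega)
    have e3 := (key (N - (x + y + 2)) x (y + 1)).2 (by omega)
    rw [growth_succ, growth_succ, e2, e3] at e1
    have e4 := congrFun e1 0
    simp only [up] at e4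
    omega
  · have e1 := mt (hX x y) hxy
    have e2 := mt (hX' x y) hxy
    push Not at e1 e2
    rw [e1, e2]

/-! ### Transposing the boundary shapes -/

/-- The growth diagrams of two fillings have conjugate shapes on the boundary of the staircase of
size `N`. -/
def ConjFilling (N : ℕ) (X Y : ℕ → ℕ → ℕ) : Prop :=
  ∀ y, Conj (growth X (N - y) y) (growth Y (N - y) y) ∧
    Conj (growth X (N - 1 - y) y) (growth Y (N - 1 - y) y)

theorem ConjFilling.symm {N : ℕ} {X Y : ℕ → ℕ → ℕ} (h : ConjFilling N X Y) :
    ConjFilling N Y X := fun y => ⟨(h y).1.symm, (h y).2.symm⟩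

theorem ConjFilling.eq {N : ℕ} {X X' Y : ℕ → ℕ → ℕ} (hX : ∀ x y, X x y ≠ 0 → x + y + 2 ≤ N)
    (hX' : ∀ x y, X' x y ≠ 0 → x + y + 2 ≤ N) (h : ConjFilling N X Y)
    (h' : ConjFilling N X' Y) : X = X' :=
  filling_eq_of_growth_eq hX hX' (fun y => (h y).1.eq (h' y).1) (fun y => (h y).2.eq (h' y).2)

/-- The top edge of column `x` joins the boundary points `(x, N - 1 - x)` and `(x + 1, N - 1 - x)`,
written here in the indexing of `ConjFilling`. The column sum is the difference of sizes along that
edge, a quantity invariant under transposition. -/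
theorem sum_col_staircase {N : ℕ} {X : ℕ → ℕ → ℕ} (hX : ∀ x y, X x y ≠ 0 → x + y + 2 ≤ N)
    {x : ℕ} (hx : x < N) : ∑ b ∈ Finset.range N, X x b +
      ∑ k ∈ Finset.range N, growth X (N - 1 - (N - 1 - x)) (N - 1 - x) k =
      ∑ k ∈ Finset.range N, growth X (N - (N - 1 - x)) (N - 1 - x) k := by
  rw [show N - 1 - (N - 1 - x) = x by omega, show N - (N - 1 - x) = x + 1 by omega,
    ← sum_growth_col X x (N - 1 - x) N (by omega),
    Finset.sum_subset (Finset.range_mono (show N - 1 - x ≤ N by omega))]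
  intro b _ hb
  by_contra h
  have := hX x b h
  rw [Finset.mem_range] at hb
  omega

theorem sum_row_staircase {N : ℕ} {X : ℕ → ℕ → ℕ} (hX : ∀ x y, X x y ≠ 0 → x + y + 2 ≤ N)
    {y : ℕ} (hy : y < N) : ∑ a ∈ Finset.range N, X a y +
      ∑ k ∈ Finset.range N, growth X (N - 1 - y) y k =
      ∑ k ∈ Finset.range N, growth X (N - (y + 1)) (y + 1) k := by
  rw [show N - (y + 1) = N - 1 - y by omega,
    ← sum_growth_row X (N - 1 - y) y N (by omega),
    Finset.sum_subset (Finset.range_mono (show N - 1 - y ≤ N by omega))]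
  intro b _ hb
  by_contra h
  have := hX b y h
  rw [Finset.mem_range] at hb
  omega

theorem exists_conjFilling {N : ℕ} {X : ℕ → ℕ → ℕ} (hX : IsPartialPerm X)
    (hs : ∀ x y, X x y ≠ 0 → x + y + 2 ≤ N) :
    ∃ Y : ℕ → ℕ → ℕ, IsPartialPerm Y ∧ (∀ x y, Y x y ≠ 0 → x + y + 2 ≤ N) ∧
      (∀ x, ∑ b ∈ Finset.range N, Y x b = ∑ b ∈ Finset.range N, X x b) ∧
      (∀ y, ∑ a ∈ Finset.range N, Y a y = ∑ a ∈ Finset.range N, X a y) ∧ ConjFilling N X Y := by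
  have hex : ∀ x y, ∃ g, Conj (growth X x y) g := fun x y =>
    exists_conj (growth_antitone X x y) (growth_eq_zero X x y y le_rfl)
  have hc0 : Conj 0 0 := fun i j => by simp
  choose g hg using hex
  have hg0 : ∀ x y, growth X x y = 0 → g x y = 0 := by
    intro x y h
    have := hg x y
    rw [h] at this
    exact this.symm.eq hc0
  have hcol : ∀ x y, Interlace (g x y) (g (x + 1) y) := fun x y =>
    (hg x y).interlace (hg (x + 1) y) (fun k => ((growth_interlace X x y).1 k).1)
      (growth_succ_le_col hX x y)
  have hrow : ∀ x y, Interlace (g x y) (g x (y + 1)) := fun x y =>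
    (hg x y).interlace (hg x (y + 1)) (fun k => ((growth_interlace X x y).2 k).1)
      (growth_succ_le_row hX x y)
  -- For `y ≥ N` truncated subtraction puts both boundary points on the axis `x = 0`, where all
  -- shapes are empty.
  have hi0 : ∀ y y', Interlace (g 0 y) (g 0 y') := by
    intro y y' k
    rw [hg0 0 y (by simp), hg0 0 y' (by simp)]
    simp
  set l : ℕ → ℕ → ℕ := fun y => g (N - y) y with hl
  set m : ℕ → ℕ → ℕ := fun y => g (N - 1 - y) y with hm
  have h1 : ∀ y, Interlace (m y) (l y) := by
    intro y
    simp only [hl, hm]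
    by_cases hy : y < N
    · rw [show N - y = N - 1 - y + 1 by omega]
      exact hcol _ _
    · rw [show N - y = 0 by omega, show N - 1 - y = 0 by omega]
      exact hi0 _ _
  have h2 : ∀ y, Interlace (m y) (l (y + 1)) := by
    intro y
    simp only [hl, hm]
    rw [show N - (y + 1) = N - 1 - y by omega]
    exact hrow _ _
  have hgr := growth_retroFilling (N := N) h1 h2 (hg0 _ _ (by simp)) (hg0 _ _ (by simp))
  set Y := retroFilling N l m with hY
  have hYs : ∀ x y, Y x y ≠ 0 → x + y + 2 ≤ N := by
    intro x y h
    by_contra hxy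
    exact h (if_neg hxy)
  have hconj : ConjFilling N X Y := by
    intro y
    by_cases hy : y < N
    · rw [hgr (N - y) y (by omega), hgr (N - 1 - y) y (by omega),
        show N - (N - y) - y = 0 by omega, show N - (N - 1 - y) - y = 1 by omega]
      exact ⟨hg _ _, hg _ _⟩
    · rw [show N - y = 0 by omega, show N - 1 - y = 0 by omega]
      simpa using hc0
  have hsz1 : ∀ y ≤ N, ∑ k ∈ Finset.range N, growth X (N - y) y k =
      ∑ k ∈ Finset.range N, growth Y (N - y) y k := fun y hy =>
    (hconj y).1.sum_eq (fun k hk => growth_eq_zero X _ _ k (by omega))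
      (fun k => (growth_le hX _ _ k).trans (by omega))
  have hsz2 : ∀ y ≤ N, ∑ k ∈ Finset.range N, growth X (N - 1 - y) y k =
      ∑ k ∈ Finset.range N, growth Y (N - 1 - y) y k := fun y hy =>
    (hconj y).2.sum_eq (fun k hk => growth_eq_zero X _ _ k (by omega))
      (fun k => (growth_le hX _ _ k).trans (by omega))
  have hsc : ∀ x, ∑ b ∈ Finset.range N, Y x b = ∑ b ∈ Finset.range N, X x b := by
    intro x
    by_cases hx : x < N
    · have e1 := sum_col_staircase hs hx
      have e2 := sum_col_staircase hYs hx
      have e3 := hsz1 (N - 1 - x) (by omega)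
      have e4 := hsz2 (N - 1 - x) (by omega)
      omega
    · rw [Finset.sum_eq_zero, Finset.sum_eq_zero]
      · intro b _
        by_contra h
        have := hs x b h
        omega
      · intro b _
        by_contra h
        have := hYs x b h
        omega
  have hsr : ∀ y, ∑ a ∈ Finset.range N, Y a y = ∑ a ∈ Finset.range N, X a y := by
    intro y
    by_cases hy : y < N
    · have e1 := sum_row_staircase hs hy
      have e2 := sum_row_staircase hYs hy
      have e3 := hsz1 (y + 1) (by omega)
      have e4 := hsz2 y (by omega)
      omega
    · rw [Finset.sum_eq_zero, Finset.sum_eq_zero]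
      · intro b _
        by_contra h
        have := hs b y h
        omega
      · intro b _
        by_contra h
        have := hYs b y h
        omega
  refine ⟨Y, ⟨fun x y => ?_, fun x y => ?_⟩, hYs, hsc, hsr, hconj⟩
  -- `Y` has no entry in this column at height `N` or above, so every partial sum is bounded by the
  -- sum up to `N`, which agrees with that of `X`.
  · refine le_trans (Finset.sum_le_sum_of_ne_zero fun b _ hb => ?_) ((hsc x).trans_le (hX.col x N))
    have := hYs x b hb
    rw [Finset.mem_range]
    omega
  · refine le_trans (Finset.sum_le_sum_of_ne_zero fun a _ ha => ?_) ((hsr y).trans_le (hX.row N y))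
    have := hYs a y ha
    rw [Finset.mem_range]
    omega

variable {N : ℕ}

/-! ### Arcs and fillings -/

theorem mem_arcs {P : SetPart N} {i j : ℕ} : (i, j) ∈ arcs P ↔
    (1 ≤ i ∧ i < j ∧ j ≤ N) ∧ ∃ B ∈ P.parts, i ∈ B ∧ j ∈ B ∧ ∀ c ∈ B, ¬ (i < c ∧ c < j) := by
  simp only [arcs, Finset.mem_filter, Finset.mem_product, Finset.mem_Icc]
  constructor
  · rintro ⟨⟨h1, h2⟩, h3, h4⟩
    exact ⟨⟨h1.1, h3, h2.2⟩, h4⟩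
  · rintro ⟨⟨h1, h2, h3⟩, h4⟩
    exact ⟨⟨⟨h1, by omega⟩, by omega, h3⟩, h2, h4⟩

theorem arcs_left_unique {P : SetPart N} {i i' j : ℕ} (h : (i, j) ∈ arcs P)
    (h' : (i', j) ∈ arcs P) : i = i' := by
  obtain ⟨h1, B, hB, hi, hj, hc⟩ := mem_arcs.1 h
  obtain ⟨h1', B', hB', hi', hj', hc'⟩ := mem_arcs.1 h'
  obtain rfl := P.eq_of_mem_parts hB hB' hj hj'
  have h2 := hc i' hi'
  have h3 := hc' i hi
  omega

theorem arcs_right_unique {P : SetPart N} {i j j' : ℕ} (h : (i, j) ∈ arcs P)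
    (h' : (i, j') ∈ arcs P) : j = j' := by
  obtain ⟨h1, B, hB, hi, hj, hc⟩ := mem_arcs.1 h
  obtain ⟨h1', B', hB', hi', hj', hc'⟩ := mem_arcs.1 h'
  obtain rfl := P.eq_of_mem_parts hB hB' hi hi'
  have h2 := hc j' hj'
  have h3 := hc' j hj
  omega

/-- The filling of the staircase of size `N` with an entry for each arc of `P`. -/
def filling (P : SetPart N) (x y : ℕ) : ℕ := if (y + 1, N - x) ∈ arcs P then 1 else 0

theorem filling_ne_zero_iff {P : SetPart N} {x y : ℕ} :
    filling P x y ≠ 0 ↔ (y + 1, N - x) ∈ arcs P := by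
  simp [filling]

theorem filling_support {P : SetPart N} (x y : ℕ) (h : filling P x y ≠ 0) : x + y + 2 ≤ N := by
  have := (mem_arcs.1 (filling_ne_zero_iff.1 h)).1
  omega

theorem filling_isPartialPerm (P : SetPart N) : IsPartialPerm (filling P) := by
  constructor
  · intro x y
    simp only [filling]
    rw [← Finset.card_filter, Finset.card_le_one]
    intro b hb b' hb'
    have := arcs_left_unique (Finset.mem_filter.1 hb).2 (Finset.mem_filter.1 hb').2
    omega
  · intro x y
    simp only [filling]
    rw [← Finset.card_filter, Finset.card_le_one]
    intro a ha a' ha'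
    have h1 := (Finset.mem_filter.1 ha).2
    have h2 := (Finset.mem_filter.1 ha').2
    have h3 := (mem_arcs.1 h1).1
    have h4 := arcs_right_unique h1 h2
    omega

theorem filling_of_arc {P : SetPart N} {i j : ℕ} (h : (i, j) ∈ arcs P) :
    filling P (N - j) (i - 1) ≠ 0 := by
  have := (mem_arcs.1 h).1
  rw [filling_ne_zero_iff, show i - 1 + 1 = i by omega, show N - (N - j) = j by omega]
  exact h

theorem exists_arc_left_iff {P : SetPart N} {e : ℕ} :
    (∃ j, (e, j) ∈ arcs P) ↔ 1 ≤ e ∧ ∃ a, filling P a (e - 1) ≠ 0 := by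
  constructor
  · rintro ⟨j, h⟩
    exact ⟨(mem_arcs.1 h).1.1, N - j, filling_of_arc h⟩
  · rintro ⟨h1, a, h⟩
    rw [filling_ne_zero_iff, show e - 1 + 1 = e by omega] at h
    exact ⟨_, h⟩

theorem exists_arc_right_iff {P : SetPart N} {e : ℕ} :
    (∃ i, (i, e) ∈ arcs P) ↔ e ≤ N ∧ ∃ b, filling P (N - e) b ≠ 0 := by
  constructor
  · rintro ⟨i, h⟩
    exact ⟨(mem_arcs.1 h).1.2.2, i - 1, filling_of_arc h⟩
  · rintro ⟨h1, b, h⟩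
    rw [filling_ne_zero_iff, show N - (N - e) = e by omega] at h
    exact ⟨_, h⟩

theorem arcs_eq_of_filling_eq {P Q : SetPart N} (h : filling P = filling Q) : arcs P = arcs Q := by
  have key : ∀ P Q : SetPart N, filling P = filling Q → arcs P ⊆ arcs Q := by
    rintro P Q h ⟨i, j⟩ hij
    have h1 := filling_of_arc hij
    have h2 := (mem_arcs.1 hij).1
    rw [h, filling_ne_zero_iff, show i - 1 + 1 = i by omega, show N - (N - j) = j by omega] at h1
    exact h1
  exact (key P Q h).antisymm (key Q P h.symm)

/-! ### Crossings and nestings in terms of the growth diagram -/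

theorem DecEnd.exists_arcs {P : SetPart N} {y k a b : ℕ} (h : DecEnd (filling P) y k a b) :
    ∃ i j : Fin (k + 1) → ℕ, (∀ r, (i r, j r) ∈ arcs P) ∧ StrictMono i ∧ StrictMono j ∧
      i 0 = b + 1 ∧ j 0 = N - a ∧ ∀ r, i r ≤ y := by
  induction k generalizing a b with
  | zero =>
    exact ⟨fun _ => b + 1, fun _ => N - a, fun _ => filling_ne_zero_iff.1 h.1,
      fun r s hrs => by omega, fun r s hrs => by omega, rfl, rfl, fun _ => h.2⟩
  | succ k ih =>
    obtain ⟨h0, a', ha, b', hb, h'⟩ := h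
    obtain ⟨i, j, hij, hi, hj, hi0, hj0, hy⟩ := ih h'
    have h1 := filling_support _ _ h'.ne_zero
    have h2 := hy 0
    refine ⟨Matrix.vecCons (b + 1) i, Matrix.vecCons (N - a) j, ?_,
      strictMono_vecCons.2 ⟨by omega, hi⟩, strictMono_vecCons.2 ⟨by omega, hj⟩, rfl, rfl, ?_⟩
    · exact Fin.cases (filling_ne_zero_iff.1 h0) hij
    · exact Fin.cases (show b + 1 ≤ y by omega) hy

theorem decEnd_of_arcs {P : SetPart N} {y k : ℕ} (i j : Fin (k + 1) → ℕ)
    (h : ∀ r, (i r, j r) ∈ arcs P) (hi : StrictMono i) (hj : StrictMono j) (hy : ∀ r, i r ≤ y) :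
    DecEnd (filling P) y k (N - j 0) (i 0 - 1) := by
  induction k with
  | zero =>
    have h1 := (mem_arcs.1 (h 0)).1
    have h2 := hy 0
    exact ⟨filling_of_arc (h 0), by omega⟩
  | succ k ih =>
    have h1 := ih (fun r => i r.succ) (fun r => j r.succ) (fun r => h _)
      (hi.comp (Fin.strictMono_succ)) (hj.comp (Fin.strictMono_succ)) (fun r => hy _)
    have h2 := (mem_arcs.1 (h 0)).1
    have h3 := (mem_arcs.1 (h (Fin.succ 0))).1
    have h4 := hi (Fin.succ_pos (0 : Fin (k + 1)))
    have h5 := hj (Fin.succ_pos (0 : Fin (k + 1)))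
    exact ⟨filling_of_arc (h 0), _, by omega, _, by omega, h1⟩

theorem IncEnd.exists_arcs {P : SetPart N} {k a b : ℕ} (h : IncEnd (filling P) k a b) :
    ∃ i j : Fin (k + 1) → ℕ, (∀ r, (i r, j r) ∈ arcs P) ∧ StrictAnti i ∧ StrictMono j ∧
      i 0 = b + 1 ∧ j 0 = N - a := by
  induction k generalizing a b with
  | zero =>
    exact ⟨fun _ => b + 1, fun _ => N - a, fun _ => filling_ne_zero_iff.1 h,
      fun r s hrs => by omega, fun r s hrs => by omega, rfl, rfl⟩
  | succ k ih =>
    obtain ⟨h0, a', ha, b', hb, h'⟩ := h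
    obtain ⟨i, j, hij, hi, hj, hi0, hj0⟩ := ih h'
    have h1 := filling_support _ _ h'.ne_zero
    have h2 := filling_support _ _ h0
    refine ⟨Matrix.vecCons (b + 1) i, Matrix.vecCons (N - a) j, ?_,
      strictAnti_vecCons.2 ⟨by omega, hi⟩, strictMono_vecCons.2 ⟨by omega, hj⟩, rfl, rfl⟩
    exact Fin.cases (filling_ne_zero_iff.1 h0) hij

theorem incEnd_of_arcs {P : SetPart N} {k : ℕ} (i j : Fin (k + 1) → ℕ)
    (h : ∀ r, (i r, j r) ∈ arcs P) (hi : StrictAnti i) (hj : StrictMono j) :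
    IncEnd (filling P) k (N - j 0) (i 0 - 1) := by
  induction k with
  | zero => exact filling_of_arc (h 0)
  | succ k ih =>
    have h1 := ih (fun r => i r.succ) (fun r => j r.succ) (fun r => h _)
      (hi.comp_strictMono (Fin.strictMono_succ)) (hj.comp (Fin.strictMono_succ))
    have h2 := (mem_arcs.1 (h 0)).1
    have h3 := (mem_arcs.1 (h (Fin.succ 0))).1
    have h4 := hi (Fin.succ_pos (0 : Fin (k + 1)))
    have h5 := hj (Fin.succ_pos (0 : Fin (k + 1)))
    exact ⟨filling_of_arc (h 0), _, by omega, _, by omega, h1⟩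

/-- The arcs of a crossing all pass over a common gap between `m` and `m + 1`, where `m` is the last
opener; conversely the corner `(N - m, m)` only sees arcs with `i ≤ m < j`, so openers precede
closers. -/
theorem hasCrossing_succ_iff {P : SetPart N} {k : ℕ} :
    HasCrossing P (k + 1) ↔ ∃ m, 0 < growth (filling P) (N - m) m k := by
  simp only [growth_pos_iff (filling_isPartialPerm P)]
  constructor
  · rintro ⟨i, j, h, hi, hj, hij⟩
    refine ⟨i (Fin.last k), _, ?_, _, decEnd_of_arcs i j h hi hj
      fun r => hi.monotone (Fin.le_last r)⟩
    have h1 := hij (Fin.last k) 0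
    have h2 := (mem_arcs.1 (h 0)).1
    omega
  · rintro ⟨m, a, ha, b, h⟩
    obtain ⟨i, j, hij, hi, hj, hi0, hj0, hm⟩ := h.exists_arcs
    refine ⟨i, j, hij, hi, hj, fun r s => ?_⟩
    have h1 := hm r
    have h2 := hj.monotone (Fin.zero_le s)
    omega

theorem hasNesting_succ_iff {P : SetPart N} {k : ℕ} :
    HasNesting P (k + 1) ↔ ∃ m, k < growth (filling P) (N - m) m 0 := by
  simp only [lt_growth_zero_iff (filling_isPartialPerm P)]
  constructor
  · rintro ⟨i, j, h, hi, hj, hij⟩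
    -- An increasing chain is read back from its end, which is the innermost arc, whereas a nesting
    -- is listed from the outermost one; hence the reversal.
    have h1 := incEnd_of_arcs (fun r => i r.rev) (fun r => j r.rev) (fun r => h _)
      (hi.comp_strictAnti Fin.rev_strictAnti) (hj.comp Fin.rev_strictAnti)
    have h2 := filling_support _ _ h1.ne_zero
    -- The gap `m` is taken right after the opener of the innermost arc.
    exact ⟨_ - 1 + 1, _, by omega, _, Nat.lt_succ_self _, h1⟩
  · rintro ⟨m, a, ha, b, hb, h⟩
    obtain ⟨i, j, hij, hi, hj, hi0, hj0⟩ := h.exists_arcs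
    refine ⟨fun r => i r.rev, fun r => j r.rev, fun r => hij _, hi.comp Fin.rev_strictAnti,
      hj.comp_strictAnti Fin.rev_strictAnti, fun r s => ?_⟩
    have h1 := hi.antitone (Fin.zero_le r.rev)
    have h2 := hj.monotone (Fin.zero_le s.rev)
    have h3 := filling_support _ _ h.ne_zero
    simp only
    omega

theorem ConjFilling.hasCrossing_iff {P Q : SetPart N}
    (h : ConjFilling N (filling P) (filling Q)) (k : ℕ) : HasCrossing P k ↔ HasNesting Q k := by
  cases k with
  | zero =>
    exact iff_of_true ⟨Fin.elim0, Fin.elim0, fun r => r.elim0, fun r => r.elim0,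
      fun r => r.elim0, fun r => r.elim0⟩ ⟨Fin.elim0, Fin.elim0, fun r => r.elim0,
      fun r => r.elim0, fun r => r.elim0, fun r => r.elim0⟩
  | succ k =>
    rw [hasCrossing_succ_iff, hasNesting_succ_iff]
    exact exists_congr fun m => (h m).1 k 0

/-! ### Matchings -/

theorem IsMatching.eq_pair {M : SetPart N} (hM : IsMatching M) {B : Finset ℕ} (hB : B ∈ M.parts)
    {i j : ℕ} (hi : i ∈ B) (hj : j ∈ B) (hij : i < j) : B = {i, j} := by
  refine (Finset.eq_of_subset_of_card_le ?_ ?_).symm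
  · intro e he
    rw [Finset.mem_insert, Finset.mem_singleton] at he
    rcases he with rfl | rfl <;> assumption
  · rw [hM B hB, Finset.card_pair hij.ne]

theorem IsMatching.mem_parts_iff {M : SetPart N} (hM : IsMatching M) {B : Finset ℕ} :
    B ∈ M.parts ↔ ∃ i j, (i, j) ∈ arcs M ∧ B = {i, j} := by
  constructor
  · intro hB
    obtain ⟨i, j, hne, rfl⟩ := Finset.card_eq_two.1 (hM B hB)
    wlog hij : i < j generalizing i j
    · rw [Finset.pair_comm] at hB ⊢
      exact this j i hne.symm hB (by omega)
    have hs := M.le hB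
    have hi := Finset.mem_Icc.1 (hs (Finset.mem_insert_self i {j}))
    have hj := Finset.mem_Icc.1 (hs (Finset.mem_insert_of_mem (Finset.mem_singleton_self j)))
    refine ⟨i, j, mem_arcs.2 ⟨⟨hi.1, hij, hj.2⟩, _, hB, by simp, by simp, ?_⟩, rfl⟩
    intro c hc
    rw [Finset.mem_insert, Finset.mem_singleton] at hc
    omega
  · rintro ⟨i, j, hij, rfl⟩
    obtain ⟨h1, B, hB, hi, hj, -⟩ := mem_arcs.1 hij
    rwa [← hM.eq_pair hB hi hj h1.2.1]

theorem IsMatching.eq_of_arcs_eq {M M' : SetPart N} (hM : IsMatching M) (hM' : IsMatching M')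
    (h : arcs M = arcs M') : M = M' := by
  ext B
  rw [hM.mem_parts_iff, hM'.mem_parts_iff, h]

theorem IsMatching.mem_minElts_iff {M : SetPart N} (hM : IsMatching M) {e : ℕ} :
    e ∈ minElts M ↔ ∃ j, (e, j) ∈ arcs M := by
  simp only [minElts, Finset.mem_filter]
  constructor
  · rintro ⟨-, B, hB, he, hmin⟩
    obtain ⟨i, j, hij, rfl⟩ := hM.mem_parts_iff.1 hB
    have h1 := (mem_arcs.1 hij).1
    have h2 := hmin i (by simp)
    rw [Finset.mem_insert, Finset.mem_singleton] at he
    obtain rfl : e = i := by omega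
    exact ⟨j, hij⟩
  · rintro ⟨j, hij⟩
    have h1 := (mem_arcs.1 hij).1
    refine ⟨Finset.mem_Icc.2 (by omega), {e, j}, hM.mem_parts_iff.2 ⟨e, j, hij, rfl⟩, by simp, ?_⟩
    intro y hy
    rw [Finset.mem_insert, Finset.mem_singleton] at hy
    omega

theorem IsMatching.mem_maxElts_iff {M : SetPart N} (hM : IsMatching M) {e : ℕ} :
    e ∈ maxElts M ↔ ∃ i, (i, e) ∈ arcs M := by
  simp only [maxElts, Finset.mem_filter]
  constructor
  · rintro ⟨-, B, hB, he, hmax⟩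
    obtain ⟨i, j, hij, rfl⟩ := hM.mem_parts_iff.1 hB
    have h1 := (mem_arcs.1 hij).1
    have h2 := hmax j (by simp)
    rw [Finset.mem_insert, Finset.mem_singleton] at he
    obtain rfl : e = j := by omega
    exact ⟨i, hij⟩
  · rintro ⟨i, hij⟩
    have h1 := (mem_arcs.1 hij).1
    refine ⟨Finset.mem_Icc.2 (by omega), {i, e}, hM.mem_parts_iff.2 ⟨i, e, hij, rfl⟩, by simp, ?_⟩
    intro y hy
    rw [Finset.mem_insert, Finset.mem_singleton] at hy
    omega

theorem IsMatching.exists_arc {M : SetPart N} (hM : IsMatching M) {e : ℕ}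
    (he : e ∈ Finset.Icc 1 N) : (∃ j, (e, j) ∈ arcs M) ∨ ∃ i, (i, e) ∈ arcs M := by
  obtain ⟨B, hB, heB⟩ := M.exists_mem he
  obtain ⟨i, j, hij, rfl⟩ := hM.mem_parts_iff.1 hB
  rw [Finset.mem_insert, Finset.mem_singleton] at heB
  rcases heB with rfl | rfl
  exacts [.inl ⟨j, hij⟩, .inr ⟨i, hij⟩]

theorem IsMatching.not_arc_of_arc {M : SetPart N} (hM : IsMatching M) {e i j : ℕ}
    (h : (e, j) ∈ arcs M) (h' : (i, e) ∈ arcs M) : False := by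
  have h1 := (mem_arcs.1 h).1
  have h2 := (mem_arcs.1 h').1
  have h3 := M.eq_of_mem_parts (hM.mem_parts_iff.2 ⟨e, j, h, rfl⟩)
    (hM.mem_parts_iff.2 ⟨i, e, h', rfl⟩) (a := e) (by simp) (by simp)
  have h4 : j ∈ ({i, e} : Finset ℕ) := h3 ▸ (by simp)
  rw [Finset.mem_insert, Finset.mem_singleton] at h4
  omega

/-- A set of arcs covering every element of `[N]` exactly once is the set of arcs of a matching. -/
theorem exists_matching_of_arcs {A : Finset (ℕ × ℕ)}
    (h1 : ∀ a ∈ A, 1 ≤ a.1 ∧ a.1 < a.2 ∧ a.2 ≤ N)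
    (h2 : ∀ e ∈ Finset.Icc 1 N, ∃ a ∈ A, e = a.1 ∨ e = a.2)
    (h3 : ∀ a ∈ A, ∀ b ∈ A, ∀ e, (e = a.1 ∨ e = a.2) → (e = b.1 ∨ e = b.2) → a = b) :
    ∃ M : SetPart N, IsMatching M ∧ arcs M = A := by
  have hm : ∀ (e : ℕ) (a : ℕ × ℕ), e ∈ ({a.1, a.2} : Finset ℕ) ↔ e = a.1 ∨ e = a.2 := by
    intro e a
    rw [Finset.mem_insert, Finset.mem_singleton]
  let M : SetPart N := Finpartition.ofExistsUnique (A.image fun a => {a.1, a.2})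
    (by
      intro p hp e he
      obtain ⟨a, ha, rfl⟩ := Finset.mem_image.1 hp
      have := h1 a ha
      rw [hm] at he
      exact Finset.mem_Icc.2 (by omega))
    (by
      intro e he
      obtain ⟨a, ha, hea⟩ := h2 e he
      refine ⟨{a.1, a.2}, ⟨Finset.mem_image_of_mem _ ha, (hm e a).2 hea⟩, ?_⟩
      rintro t ⟨ht, het⟩
      obtain ⟨b, hb, rfl⟩ := Finset.mem_image.1 ht
      rw [h3 a ha b hb e hea ((hm e b).1 het)])
    (by
      intro h
      obtain ⟨a, -, ha⟩ := Finset.mem_image.1 h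
      exact Finset.insert_ne_empty _ _ ha)
  have hMp : ∀ B, B ∈ M.parts ↔ ∃ a ∈ A, {a.1, a.2} = B := fun B => Finset.mem_image
  have hM : IsMatching M := by
    intro B hB
    obtain ⟨a, ha, rfl⟩ := (hMp B).1 hB
    exact Finset.card_pair (h1 a ha).2.1.ne
  refine ⟨M, hM, ?_⟩
  ext ⟨i, j⟩
  constructor
  · intro h
    obtain ⟨a, ha, hB⟩ := (hMp _).1 (hM.mem_parts_iff.2 ⟨i, j, h, rfl⟩)
    have h4 := h1 a ha
    have h5 := (mem_arcs.1 h).1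
    have h6 := (hm i a).1 (hB ▸ by simp)
    have h7 := (hm j a).1 (hB ▸ by simp)
    obtain rfl : a = (i, j) := Prod.ext (by simp only; omega) (by simp only; omega)
    exact ha
  · intro h
    have h4 := h1 _ h
    refine mem_arcs.2 ⟨h4, {i, j}, (hMp _).2 ⟨_, h, rfl⟩, by simp, by simp, ?_⟩
    intro c hc
    rw [Finset.mem_insert, Finset.mem_singleton] at hc
    simp only at h4
    omega

theorem sum_row_ne_zero_iff {X : ℕ → ℕ → ℕ} (hX : ∀ x y, X x y ≠ 0 → x + y + 2 ≤ N) (y : ℕ) :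
    ∑ a ∈ Finset.range N, X a y ≠ 0 ↔ ∃ a, X a y ≠ 0 := by
  rw [Ne, Finset.sum_eq_zero_iff]
  push Not
  refine exists_congr fun a => and_iff_right_of_imp fun h => ?_
  have := hX a y h
  exact Finset.mem_range.2 (by omega)

theorem sum_col_ne_zero_iff {X : ℕ → ℕ → ℕ} (hX : ∀ x y, X x y ≠ 0 → x + y + 2 ≤ N) (x : ℕ) :
    ∑ b ∈ Finset.range N, X x b ≠ 0 ↔ ∃ b, X x b ≠ 0 := by
  rw [Ne, Finset.sum_eq_zero_iff]
  push Not
  refine exists_congr fun b => and_iff_right_of_imp fun h => ?_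
  have := hX x b h
  exact Finset.mem_range.2 (by omega)

/-- Every matching has a conjugate matching with the same openers and closers. -/
theorem IsMatching.exists_conj {M : SetPart N} (hM : IsMatching M) :
    ∃ M' : SetPart N, IsMatching M' ∧ minElts M' = minElts M ∧ maxElts M' = maxElts M ∧
      ConjFilling N (filling M) (filling M') := by
  obtain ⟨Y, hY, hYs, hcol, hrow, hconj⟩ :=
    exists_conjFilling (filling_isPartialPerm M) (filling_support (P := M))
  -- Nonzero row sums mark the openers and nonzero column sums the closers, so both sets are those
  -- of `M`.
  have hr : ∀ y, (∃ a, Y a y ≠ 0) ↔ ∃ a, filling M a y ≠ 0 := fun y => by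
    rw [← sum_row_ne_zero_iff hYs, hrow, sum_row_ne_zero_iff filling_support]
  have hc : ∀ x, (∃ b, Y x b ≠ 0) ↔ ∃ b, filling M x b ≠ 0 := fun x => by
    rw [← sum_col_ne_zero_iff hYs, hcol, sum_col_ne_zero_iff filling_support]
  set A : Finset (ℕ × ℕ) := (Finset.Icc 1 N ×ˢ Finset.Icc 1 N).filter
    fun a => Y (N - a.2) (a.1 - 1) ≠ 0 with hA
  have hmem : ∀ i j, (i, j) ∈ A ↔
      ((1 ≤ i ∧ i ≤ N) ∧ 1 ≤ j ∧ j ≤ N) ∧ Y (N - j) (i - 1) ≠ 0 := fun i j => by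
    simp only [hA, Finset.mem_filter, Finset.mem_product, Finset.mem_Icc]
  have hmem' : ∀ x y, (y + 1, N - x) ∈ A ↔ Y x y ≠ 0 := by
    intro x y
    rw [hmem, Nat.add_sub_cancel]
    constructor
    · rintro ⟨h1, h2⟩
      rwa [show N - (N - x) = x by omega] at h2
    · intro h
      have := hYs x y h
      rw [show N - (N - x) = x by omega]
      exact ⟨by omega, h⟩
  obtain ⟨M', hM', hAM⟩ := exists_matching_of_arcs (N := N) (A := A)
    (by
      rintro ⟨i, j⟩ h
      have h1 := (hmem i j).1 h
      have h2 := hYs _ _ h1.2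
      simp only
      omega)
    (by
      intro e he
      have he' := Finset.mem_Icc.1 he
      rcases hM.exists_arc he with h | h
      · obtain ⟨a, ha⟩ := (hr _).2 (exists_arc_left_iff.1 h).2
        have := (hmem' _ _).2 ha
        exact ⟨_, this, .inl (by simp only; omega)⟩
      · obtain ⟨b, hb⟩ := (hc _).2 (exists_arc_right_iff.1 h).2
        have := (hmem' _ _).2 hb
        exact ⟨_, this, .inr (by simp only; omega)⟩)
    (by
      -- No element is an opener and a closer at once, since this holds in `M` and the two sets are
      -- unchanged.
      have hmix : ∀ e i j, (e, j) ∈ A → (i, e) ∈ A → False := by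
        intro e i j h h'
        have h1 := (hmem _ _).1 h
        have h2 := (hmem _ _).1 h'
        obtain ⟨j', hj'⟩ := exists_arc_left_iff.2 ⟨h1.1.1.1, (hr _).1 ⟨_, h1.2⟩⟩
        obtain ⟨i', hi'⟩ := exists_arc_right_iff.2 ⟨h2.1.2.2, (hc _).1 ⟨_, h2.2⟩⟩
        exact hM.not_arc_of_arc hj' hi'
      rintro ⟨i, j⟩ h ⟨i', j'⟩ h' e (rfl | rfl) (he | he)
      · simp only at he
        subst he
        have h1 := (hmem _ _).1 h
        have h2 := (hmem _ _).1 h'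
        have h3 := hY.row_unique h1.2 h2.2
        exact Prod.ext rfl (by simp only; omega)
      · simp only at he
        subst he
        exact (hmix _ _ _ h h').elim
      · simp only at he
        subst he
        exact (hmix _ _ _ h' h).elim
      · simp only at he
        subst he
        have h1 := (hmem _ _).1 h
        have h2 := (hmem _ _).1 h'
        have h3 := hY.col_unique h1.2 h2.2
        exact Prod.ext (by simp only; omega) rfl)
  have hfill : filling M' = Y := by
    funext x y
    have h1 := hmem' x y
    have h2 := hY.le_one x y
    rw [filling, hAM]
    split_ifs with h
    · have := h1.1 h
      omega
    · have := mt h1.2 h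
      omega
  refine ⟨M', hM', ?_, ?_, hfill ▸ hconj⟩
  · ext e
    rw [hM.mem_minElts_iff, hM'.mem_minElts_iff, exists_arc_left_iff, exists_arc_left_iff, hfill,
      hr]
  · ext e
    rw [hM.mem_maxElts_iff, hM'.mem_maxElts_iff, exists_arc_right_iff, exists_arc_right_iff, hfill,
      hc]

/-! ### Counting by conjugation -/

/-- Conjugation is a bijection on matchings, so it transports any count that it respects. -/
theorem ncard_eq_of_conj (p q : SetPart N → Prop) (hp : ∀ M, p M → IsMatching M)
    (hq : ∀ M, q M → IsMatching M)
    (h : ∀ M M' : SetPart N, IsMatching M → IsMatching M' → minElts M' = minElts M →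
      maxElts M' = maxElts M → ConjFilling N (filling M) (filling M') → (p M ↔ q M')) :
    {M | p M}.ncard = {M | q M}.ncard := by
  -- An injection in each direction suffices, because the conjugacy relation is symmetric.
  have key : ∀ p q : SetPart N → Prop, (∀ M, p M → IsMatching M) →
      (∀ M M' : SetPart N, IsMatching M → IsMatching M' → minElts M' = minElts M →
        maxElts M' = maxElts M → ConjFilling N (filling M) (filling M') → p M → q M') →
      {M | p M}.ncard ≤ {M | q M}.ncard := by
    intro p q hp h
    have hex : ∀ M : SetPart N, ∃ M' : SetPart N, IsMatching M → IsMatching M' ∧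
        minElts M' = minElts M ∧ maxElts M' = maxElts M ∧
        ConjFilling N (filling M) (filling M') := by
      intro M
      by_cases hM : IsMatching M
      · obtain ⟨M', h'⟩ := hM.exists_conj
        exact ⟨M', fun _ => h'⟩
      · exact ⟨M, fun h => (hM h).elim⟩
    choose φ hφ using hex
    refine Set.ncard_le_ncard_of_injOn φ ?_ ?_ (Set.toFinite _)
    · intro M hM
      obtain ⟨h1, h2, h3, h4⟩ := hφ M (hp M hM)
      exact h M _ (hp M hM) h1 h2 h3 h4 hM
    · intro M hM M₁ hM₁ he
      -- Two matchings with the same conjugate have fillings with the same boundary shapes, hence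
      -- the same filling and the same arcs.
      have h1 := (hφ M (hp M hM)).2.2.2
      have h2 := (hφ M₁ (hp M₁ hM₁)).2.2.2
      rw [← he] at h2
      exact (hp M hM).eq_of_arcs_eq (hp M₁ hM₁)
        (arcs_eq_of_filling_eq (h1.eq filling_support filling_support h2))
  refine le_antisymm (key p q hp fun M M' a b c d e => (h M M' a b c d e).1)
    (key q p hq fun M M' a b c d e => ?_)
  exact (h M' M b a c.symm d.symm e.symm).2

theorem ConjFilling.cr_eq {P Q : SetPart N} (h : ConjFilling N (filling P) (filling Q)) :
    cr P = ne Q := by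
  simp only [cr, ne, h.hasCrossing_iff]

theorem ConjFilling.ne_eq {P Q : SetPart N} (h : ConjFilling N (filling P) (filling Q)) :
    ne P = cr Q := h.symm.cr_eq.symm

/-- By cardinality the minimal and maximal elements exhaust `[N]`, so each element of a block is its
minimum or its maximum, and these two differ by disjointness. -/
theorem isMatching_of_disjoint {S T : Finset ℕ} (hS : S ⊆ Finset.Icc 1 N)
    (hT : T ⊆ Finset.Icc 1 N) (hcard : S.card + T.card = N) (hST : Disjoint S T)
    {P : SetPart N} (hP : P ∈ partsWith N S T) : IsMatching P := by
  obtain ⟨rfl, rfl⟩ := hP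
  have hun : minElts P ∪ maxElts P = Finset.Icc 1 N := by
    refine Finset.eq_of_subset_of_card_le (Finset.union_subset hS hT) ?_
    rw [Finset.card_union_of_disjoint hST, Nat.card_Icc]
    omega
  intro B hB
  have hne := P.nonempty_of_mem_parts hB
  have hmin := B.min'_mem hne
  have hmax := B.max'_mem hne
  have h1 : B.min' hne ∈ minElts P :=
    Finset.mem_filter.2 ⟨P.le hB hmin, B, hB, hmin, fun y hy => B.min'_le y hy⟩
  have h2 : B.max' hne ∈ maxElts P :=
    Finset.mem_filter.2 ⟨P.le hB hmax, B, hB, hmax, fun y hy => B.le_max' y hy⟩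
  have h3 : B = {B.min' hne, B.max' hne} := by
    refine Finset.Subset.antisymm (fun e he => ?_) (fun e he => ?_)
    · have h4 : e ∈ minElts P ∪ maxElts P := hun ▸ P.le hB he
      rw [Finset.mem_insert, Finset.mem_singleton]
      rcases Finset.mem_union.1 h4 with h | h
      · obtain ⟨-, B', hB', heB', hm⟩ := Finset.mem_filter.1 h
        obtain rfl := P.eq_of_mem_parts hB hB' he heB'
        exact .inl (le_antisymm (hm _ hmin) (B.min'_le e he))
      · obtain ⟨-, B', hB', heB', hm⟩ := Finset.mem_filter.1 h
        obtain rfl := P.eq_of_mem_parts hB hB' he heB'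
        exact .inr (le_antisymm (B.le_max' e he) (hm _ hmax))
    · rw [Finset.mem_insert, Finset.mem_singleton] at he
      rcases he with rfl | rfl <;> assumption
  rw [h3, Finset.card_pair]
  intro h
  exact Finset.disjoint_left.1 hST h1 (h ▸ h2)

end CrossNest

theorem corollary1p4 (n : ℕ) :
    (∀ S T : Finset ℕ, S ⊆ Finset.Icc 1 (2 * n) → T ⊆ Finset.Icc 1 (2 * n) →
      S.card = n → T.card = n → Disjoint S T →
        (∀ P ∈ CrossNest.partsWith (2 * n) S T, CrossNest.IsMatching P) ∧
        ∀ i j : ℕ, CrossNest.fST (2 * n) S T i j = CrossNest.fST (2 * n) S T j i) ∧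
    (∀ i j : ℕ, CrossNest.f n i j = CrossNest.f n j i) ∧
    (∀ k l : ℕ,
      {M : CrossNest.SetPart (2 * n) | CrossNest.IsMatching M ∧
        CrossNest.IsNoncrossing M k ∧ CrossNest.IsNonnesting M l}.ncard =
      {M : CrossNest.SetPart (2 * n) | CrossNest.IsMatching M ∧
        CrossNest.IsNoncrossing M l ∧ CrossNest.IsNonnesting M k}.ncard) ∧
    (∀ k : ℕ,
      {M : CrossNest.SetPart (2 * n) | CrossNest.IsMatching M ∧
        CrossNest.IsNoncrossing M k}.ncard =
      {M : CrossNest.SetPart (2 * n) | CrossNest.IsMatching M ∧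
        CrossNest.IsNonnesting M k}.ncard) := by
  refine ⟨fun S T hS hT hSn hTn hST => ?_, fun i j => ?_, fun k l => ?_, fun k => ?_⟩
  · have hmat : ∀ P ∈ CrossNest.partsWith (2 * n) S T, CrossNest.IsMatching P := fun P hP =>
      CrossNest.isMatching_of_disjoint hS hT (by omega) hST hP
    refine ⟨hmat, fun i j => CrossNest.ncard_eq_of_conj _ _ (fun M h => hmat M h.1)
      (fun M h => hmat M h.1) fun M M' _ _ hmin hmax h => ?_⟩
    rw [CrossNest.partsWith, Set.mem_ofPred_eq, Set.mem_ofPred_eq, hmin, hmax, h.cr_eq, h.ne_eq,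
      and_comm (a := CrossNest.ne M' = i)]
  · refine CrossNest.ncard_eq_of_conj _ _ (fun M h => h.1) (fun M h => h.1)
      fun M M' hM hM' _ _ h => ?_
    rw [iff_true_intro hM, iff_true_intro hM', h.cr_eq, h.ne_eq,
      and_comm (a := CrossNest.ne M' = i)]
  · refine CrossNest.ncard_eq_of_conj _ _ (fun M h => h.1) (fun M h => h.1)
      fun M M' hM hM' _ _ h => ?_
    rw [iff_true_intro hM, iff_true_intro hM', CrossNest.IsNoncrossing, CrossNest.IsNonnesting,
      CrossNest.IsNoncrossing, CrossNest.IsNonnesting, h.hasCrossing_iff, h.symm.hasCrossing_iff,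
      and_comm (a := ¬ CrossNest.HasNesting M' k)]
  · refine CrossNest.ncard_eq_of_conj _ _ (fun M h => h.1) (fun M h => h.1)
      fun M M' hM hM' _ _ h => ?_
    rw [iff_true_intro hM, iff_true_intro hM', CrossNest.IsNoncrossing, CrossNest.IsNonnesting,
      h.hasCrossing_iff]
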